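/- Let $G'$ be a finite simple undirected graph, let $e=\{u,v\}$ be an edge of $G'$, and let $G=G'-e$ be the graph obtained by deleting $e$; assume that $G$ (hence also $G'$) is connected. Let $\Gamma$ be the set of spanning trees of $G$ (equivalently, the spanning trees of $G'$ that do not contain $e$), and let $\Gamma'_e$ be the set of spanning trees of $G'$ that contain $e$. Let $R(e)$ be the effective resistance between $u$ and $v$ in $G'$ with unit resistances, i.e. $R(e)=(\delta_u-\delta_v)^{\top}L^{\dagger}(\delta_u-\delta_v)$, where $L^{\dagger}$ is the Moore–Penrose pseudo-inverse of the Laplacian $L=D-A$ of $G'$. A link-cut operation with $e$ on a spanning tree $\tau\not\ni e$ adds $e$ to $\tau$ and then removes one edge other than $e$ of the cycle so created. A cut-link operation with $e$ on a spanning tree $\tau_e\ni e$ removes $e$ from $\tau_e$ and then adds an edge of $G'$ other than $e$ that reconnects the two resulting components. Let $\mathcal B$ be the bipartite graph whose nodes are the spanning trees of $G'$, i.e. the elements of $\Gamma\cup\Gamma'_e$, two of them being adjacent if one can be transformed into the other by a link-cut operation with $e$. Write $N_{\mathcal B}(\tau)$ for the set of neighbours and $d(\tau)=|N_{\mathcal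 B}(\tau)|$ for the degree of $\tau$ in $\mathcal B$, and $U(S)$ for the uniform distribution on a finite non-empty set $S$. Then for every $\tau_e\in\Gamma'_e$ the set $N_{\mathcal B}(\tau_e)$ consists precisely of the trees that result from $\tau_e$ by a cut-link operation with $e$; the sets $\Gamma$, $\Gamma'_e$ and $N_{\mathcal B}(\tau_e)$ for $\tau_e\in\Gamma'_e$ are non-empty, $d(\tau)>0$ for all $\tau\in\Gamma$, and $R(e)<1$; and for every real-valued function $f$ on trees, $$\mathbb E_{\tau\sim U(\Gamma)}[f(\tau)]=\frac{R(e)}{1-R(e)}\;\mathbb E_{\tau_e\sim U(\Gamma'_e)}\left[\mathbb E_{\tau\sim U(N_{\mathcal B}(\tau_e))}\left[f(\tau)\,\frac{d(\tau_e)}{d(\tau)}\right]\right].$$ -/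

import Mathlib

open scoped BigOperators

namespace TreeMaintenance

variable {V : Type*}

open Classical in
/-- The Moore-Penrose pseudo-inverse of the graph Laplacian `L = D - A`, through an orthonormal
eigenbasis: the sum of `σ i⁻¹ • w i * (w i)ᵀ` over the nonzero eigenvalues `σ i` of `L`. -/
noncomputable def lapPseudoInv [Fintype V] (G : SimpleGraph V) : Matrix V V ℝ :=
  let hL : (G.lapMatrix ℝ).IsHermitian := G.isHermitian_lapMatrix ℝ
  ∑ i with hL.eigenvalues i ≠ 0,
    (hL.eigenvalues i)⁻¹ • Matrix.of fun x y => hL.eigenvectorBasis i x * hL.eigenvectorBasis i y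

/-- The effective resistance between `u` and `v` in `G` (every edge being a unit resistor):
`(δ_u - δ_v)ᵀ L† (δ_u - δ_v)`. -/
noncomputable def effectiveResistance [Fintype V] (G : SimpleGraph V) (u v : V) : ℝ :=
  let P := lapPseudoInv G
  P u u - P u v - P v u + P v v

open Classical in
/-- The set of spanning trees of `G`; a spanning tree is a subgraph of `G` on all of `V` which is a
tree. -/
noncomputable def spanningTrees [Fintype V] (G : SimpleGraph V) : Finset (SimpleGraph V) :=
  {τ | τ ≤ G ∧ τ.IsTree}

open Classical in
/-- The set of spanning trees of `G` that contain the edge `e`. -/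
noncomputable def spanningTreesThrough [Fintype V] (G : SimpleGraph V) (e : Sym2 V) :
    Finset (SimpleGraph V) :=
  {τ ∈ spanningTrees G | e ∈ τ.edgeSet}

/-- `τ'` results from `τ` by a link-cut operation with the edge `uv`: the edge `uv`, not in `τ`, is
linked, and one of the other edges `g` of the cycle so created, that is, an edge of the path of `τ`
from `u` to `v`, is cut. -/
def IsLinkCut (u v : V) (τ τ' : SimpleGraph V) : Prop :=
  s(u, v) ∉ τ.edgeSet ∧
    ∃ (p : τ.Walk u v) (g : Sym2 V), p.IsPath ∧ g ∈ p.edges ∧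
      τ' = (τ ⊔ SimpleGraph.fromEdgeSet {s(u, v)}).deleteEdges {g}

/-- `τ'` results from `τ` by a cut-link operation with the edge `e` in the graph `G`: the edge `e`
of `τ` is cut, and another edge `g` of `G` is linked so that the two parts are connected again. -/
def IsCutLink (G : SimpleGraph V) (e : Sym2 V) (τ τ' : SimpleGraph V) : Prop :=
  e ∈ τ.edgeSet ∧
    ∃ g ∈ G.edgeSet, g ≠ e ∧
      τ' = τ.deleteEdges {e} ⊔ SimpleGraph.fromEdgeSet {g} ∧ τ'.Connected

/-- The link-cut graph of `G` with respect to the edge `uv`: its nodes are the spanning trees of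
`G`, and two of them are adjacent if one results from the other by a link-cut operation with `uv`.
(All other elements of `SimpleGraph V` are isolated.) -/
def linkCutGraph [Fintype V] (G : SimpleGraph V) (u v : V) : SimpleGraph (SimpleGraph V) :=
  SimpleGraph.fromRel fun τ τ' =>
    τ ∈ spanningTrees G ∧ τ' ∈ spanningTrees G ∧ IsLinkCut u v τ τ'

open Classical in
/-- The set of neighbours of `τ` in the link-cut graph. -/
noncomputable def linkCutNeighbors [Fintype V] (G : SimpleGraph V) (u v : V) (τ : SimpleGraph V) :
    Finset (SimpleGraph V) :=
  (linkCutGraph G u v).neighborFinset τ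

open Classical in
/-- The degree of `τ` in the link-cut graph. -/
noncomputable def linkCutDegree [Fintype V] (G : SimpleGraph V) (u v : V) (τ : SimpleGraph V) : ℕ :=
  (linkCutGraph G u v).degree τ

end TreeMaintenance

open SimpleGraph

/-! ### Trees and forests with two components -/

namespace TreeMaintenance

/-! Weight each edge $(\tau,\tau_e)$ of $\mathcal B$ by $f(\tau)/d(\tau)$. Grouped by $\tau$ the
total is $\sum_\Gamma f$; grouped by $\tau_e$ it is the sum of the inner expectations, as
$d(\tau_e)$ undoes the averaging (`sum_expect_linkCutNeighbors`). What remains is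
$R/(1-R)=|\Gamma'_e|/|\Gamma|$, which is Kirchhoff's theorem (`card_mul_effectiveResistance`).

For the latter, let $\varphi(x)$ count the two-component forests separating $u$ from $v$ with $x$ on
the side of $u$. Across an edge $xy$, $\varphi$ drops by the net number of trees whose $u$-$v$ path
runs from $x$ to $y$. Each tree thus carries one unit of current, so
$L\varphi=|\Gamma\cup\Gamma'_e|(\delta_u-\delta_v)$, while $\varphi(u)-\varphi(v)=|\Gamma'_e|$.

Link-cut and cut-link are inverse because both pass through the same forest $\tau-g=\tau_e-e$. -/

/-- A property that is passed on along the edges of a preconnected graph holds everywhere as soon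
as it holds at one vertex. -/
theorem forall_of_preconnected {V : Type*} {G : SimpleGraph V} (hG : G.Preconnected) {P : V → Prop}
    (hP : ∀ x y, G.Adj x y → P x → P y) {a : V} (ha : P a) (z : V) : P z := by
  obtain ⟨p⟩ := hG a z
  induction p with
  | nil => exact ha
  | cons h _ ih => exact ih (hP _ _ h ha)

/-- `F` is a spanning forest with precisely two components, one of them containing `a` and the
other one `b`. -/
structure IsTwoForest {V : Type*} (F : SimpleGraph V) (a b : V) : Prop where
  isAcyclic : F.IsAcyclic
  not_reachable : ¬F.Reachable a b
  reachable_or : ∀ z, F.Reachable z a ∨ F.Reachable z b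

namespace IsTwoForest

variable {V : Type*} {F : SimpleGraph V} {a b c d : V}

theorem symm (h : IsTwoForest F a b) : IsTwoForest F b a :=
  ⟨h.isAcyclic, fun hr => h.not_reachable hr.symm, fun z => (h.reachable_or z).symm⟩

theorem ne (h : IsTwoForest F a b) : a ≠ b := by
  rintro rfl
  exact h.not_reachable (Reachable.refl _)

theorem not_adj (h : IsTwoForest F a b) : ¬F.Adj a b := fun hab => h.not_reachable hab.reachable

/-- With only two components, any two unconnected vertices represent both. -/
theorem of_not_reachable (h : IsTwoForest F a b) (hcd : ¬F.Reachable c d) : IsTwoForest F c d := by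
  refine ⟨h.isAcyclic, hcd, fun z => ?_⟩
  rcases h.reachable_or c with hc | hc <;> rcases h.reachable_or d with hd | hd <;>
    rcases h.reachable_or z with hz | hz <;>
    first
    | exact absurd (hc.trans hd.symm) hcd
    | exact Or.inl (hz.trans hc.symm)
    | exact Or.inr (hz.trans hd.symm)

theorem reachable_right_iff (h : IsTwoForest F a b) (z : V) :
    F.Reachable z b ↔ ¬F.Reachable a z :=
  ⟨fun hz ha => h.not_reachable (ha.trans hz), fun hz =>
    (h.reachable_or z).resolve_left fun hr => hz hr.symm⟩

theorem isTree_sup_edge (h : IsTwoForest F a b) : (F ⊔ edge a b).IsTree := by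
  refine ⟨(connected_iff _).2 ⟨?_, ⟨a⟩⟩, h.isAcyclic.sup_edge_of_not_reachable h.not_reachable⟩
  have hab : (F ⊔ edge a b).Reachable b a :=
    Adj.reachable (Or.inr ((edge_adj ..).2 ⟨Or.inr ⟨rfl, rfl⟩, h.ne.symm⟩))
  have key : ∀ z, (F ⊔ edge a b).Reachable z a := fun z => by
    rcases h.reachable_or z with hz | hz
    · exact hz.mono le_sup_left
    · exact (hz.mono le_sup_left).trans hab
  exact fun x y => (key x).trans (key y).symm

theorem deleteEdges_sup_edge (h : IsTwoForest F a b) :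
    (F ⊔ edge a b).deleteEdges {s(a, b)} = F := by
  ext x y
  have := h.not_adj
  have := h.symm.not_adj
  simp only [deleteEdges_adj, sup_adj, edge_adj, Set.mem_singleton_iff, Sym2.eq_iff]
  grind

theorem sup_edge_eq_iff (h : IsTwoForest F a b) {τ : SimpleGraph V} (hτ : τ.Adj a b) :
    F ⊔ edge a b = τ ↔ F = τ.deleteEdges {s(a, b)} := by
  constructor
  · rintro rfl
    exact h.deleteEdges_sup_edge.symm
  · rintro rfl
    ext x y
    have := hτ.symm
    have := hτ.ne
    simp only [deleteEdges_adj, sup_adj, edge_adj, Set.mem_singleton_iff, Sym2.eq_iff]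
    grind

end IsTwoForest

variable {V : Type*} {τ G : SimpleGraph V} {a b : V}

theorem isTwoForest_deleteEdges (hτ : τ.IsTree) (hab : τ.Adj a b) :
    IsTwoForest (τ.deleteEdges {s(a, b)}) a b := by
  refine ⟨hτ.isAcyclic.anti (deleteEdges_le _), ?_, ?_⟩
  · exact isBridge_iff.1 (isAcyclic_iff_forall_adj_isBridge.1 hτ.isAcyclic hab)
  · refine forall_of_preconnected hτ.connected.preconnected (fun x y hxy hx => ?_)
      (Or.inl (Reachable.refl a))
    by_cases he : s(x, y) = s(a, b)
    · rcases Sym2.eq_iff.1 he with ⟨-, rfl⟩ | ⟨-, rfl⟩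
      · exact Or.inr (Reachable.refl _)
      · exact Or.inl (Reachable.refl _)
    · have : (τ.deleteEdges {s(a, b)}).Reachable y x :=
        Adj.reachable (deleteEdges_adj.2 ⟨hxy.symm, by rwa [Set.mem_singleton_iff, Sym2.eq_swap]⟩)
      exact hx.imp this.trans this.trans

theorem deleteEdges_sup_edge (hab : τ.Adj a b) : τ.deleteEdges {s(a, b)} ⊔ edge a b = τ := by
  ext x y
  have := hab.symm
  have := hab.ne
  simp only [deleteEdges_adj, sup_adj, edge_adj, Set.mem_singleton_iff, Sym2.eq_iff]
  grind

/-- An edge of a tree lies on the path between two vertices precisely if it separates them. -/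
theorem mem_edges_iff_not_reachable (hτ : τ.IsAcyclic) {p : τ.Walk a b} (hp : p.IsPath) {g : Sym2 V} :
    g ∈ p.edges ↔ ¬(τ.deleteEdges {g}).Reachable a b := by
  classical
  constructor
  · rintro hg ⟨q⟩
    have hq := q.toPath.2.mapLe (deleteEdges_le {g})
    have := congrArg Subtype.val ((hτ.subsingleton_path a b).elim ⟨p, hp⟩ ⟨_, hq⟩)
    simp only at this
    rw [this, Walk.edges_mapLe_eq_edges] at hg
    have := Walk.edges_subset_edgeSet _ hg
    simp at this
  · intro h
    by_contra hg
    exact h ⟨p.toDeleteEdge g hg⟩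

/-- The neighbour of `x` in a tree towards another vertex `w` is unique. -/
theorem existsUnique_adj_reachable (hτ : τ.IsTree) {x w : V} (hxw : x ≠ w) :
    ∃! y, τ.Adj x y ∧ (τ.deleteEdges {s(x, y)}).Reachable y w := by
  classical
  obtain ⟨p, hp, hu⟩ := hτ.existsUnique_path x w
  cases p with
  | nil => exact absurd rfl hxw
  | @cons _ y _ hxy q =>
    rw [Walk.cons_isPath_iff] at hp
    refine ⟨y, ⟨hxy, ?_⟩, ?_⟩
    · exact ⟨q.toDeleteEdge _ fun h => hp.2 (q.fst_mem_support_of_mem_edges h)⟩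
    -- A walk from `z` to `w` that met `x` would bypass the bridge `xz`; so prepending `x` gives a
    -- path, which must be the unique one.
    · rintro z ⟨hxz, ⟨r⟩⟩
      have hbr := (isTwoForest_deleteEdges hτ hxz).not_reachable
      have hx : x ∉ r.toPath.1.support := fun h =>
        hbr (r.toPath.1.takeUntil x h).reachable.symm
      have hr := r.toPath.2.mapLe (deleteEdges_le {s(x, z)})
      have := hu (Walk.cons hxz _) ((Walk.cons_isPath_iff ..).2 ⟨hr, by simpa using hx⟩)
      exact (Walk.cons.inj this).1

end TreeMaintenance

/-! ### Forest counts as an electrical potential -/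

namespace TreeMaintenance

open Classical in
/-- The set of spanning forests of `G` with two components that separate `u` from `v`. -/
noncomputable def separatingForests {V : Type*} [Fintype V] (G : SimpleGraph V) (u v : V) :
    Finset (SimpleGraph V) :=
  {F | F ≤ G ∧ IsTwoForest F u v}

section Counting

variable {V : Type*} [Fintype V] {G : SimpleGraph V} {u v : V}

theorem mem_spanningTrees {τ : SimpleGraph V} : τ ∈ spanningTrees G ↔ τ ≤ G ∧ τ.IsTree := by
  simp [spanningTrees]

theorem mem_spanningTreesThrough {τ : SimpleGraph V} :
    τ ∈ spanningTreesThrough G s(u, v) ↔ (τ ≤ G ∧ τ.IsTree) ∧ τ.Adj u v := by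
  simp [spanningTreesThrough, mem_spanningTrees]

theorem mem_separatingForests {F : SimpleGraph V} :
    F ∈ separatingForests G u v ↔ F ≤ G ∧ IsTwoForest F u v := by
  simp [separatingForests]

open Classical in
/-- Forests with `x` in the component of `u` and `y` in the one of `v` correspond to spanning
trees whose path from `u` to `v` passes the edge `xy` in the direction from `x` to `y`. -/
theorem card_separatingForests_filter {x y : V} (hxy : G.Adj x y) :
    (separatingForests G u v |>.filter fun F => F.Reachable u x ∧ ¬F.Reachable u y).card =
      (spanningTrees G |>.filter fun τ => τ.Adj x y ∧
        (τ.deleteEdges {s(x, y)}).Reachable u x ∧ (τ.deleteEdges {s(x, y)}).Reachable y v).card := by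
  have hfor : ∀ F, IsTwoForest F u v → F.Reachable u x → ¬F.Reachable u y → IsTwoForest F x y :=
    fun F hF hx hy => hF.of_not_reachable fun h => hy (hx.trans h)
  refine Finset.card_nbij' (fun F => F ⊔ edge x y) (fun τ => τ.deleteEdges {s(x, y)}) ?_ ?_ ?_ ?_
  · intro F hF
    simp only [Finset.mem_coe, Finset.mem_filter, mem_separatingForests, mem_spanningTrees] at hF ⊢
    obtain ⟨⟨hle, hF⟩, hx, hy⟩ := hF
    have hxyF := hfor F hF hx hy
    rw [hxyF.deleteEdges_sup_edge]
    exact ⟨⟨sup_le hle (edge_le_iff _ |>.2 (Or.inr hxy)), hxyF.isTree_sup_edge⟩,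
      Or.inr ((edge_adj ..).2 ⟨Or.inl ⟨rfl, rfl⟩, hxy.ne⟩), hx, (hF.reachable_right_iff y).2 hy⟩
  · intro τ hτ
    simp only [Finset.mem_coe, Finset.mem_filter, mem_separatingForests, mem_spanningTrees] at hτ ⊢
    obtain ⟨⟨hle, hτ⟩, hadj, hx, hy⟩ := hτ
    have hF := isTwoForest_deleteEdges hτ hadj
    have huv : ¬(τ.deleteEdges {s(x, y)}).Reachable u v := fun h =>
      hF.not_reachable ((hx.symm.trans h).trans hy.symm)
    exact ⟨⟨(deleteEdges_le _).trans hle, hF.of_not_reachable huv⟩, hx,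
      fun h => huv (h.trans hy)⟩
  · intro F hF
    simp only [Finset.mem_coe, Finset.mem_filter, mem_separatingForests] at hF
    exact (hfor F hF.1.2 hF.2.1 hF.2.2).deleteEdges_sup_edge
  · intro τ hτ
    simp only [Finset.mem_coe, Finset.mem_filter] at hτ
    exact deleteEdges_sup_edge hτ.2.1

open Classical in
/-- The potential induced by `#(spanning trees)` units of current from `u` to `v`: the number of
separating forests with `x` in the component of `u`. -/
noncomputable def forestPotential (G : SimpleGraph V) (u v x : V) : ℝ :=
  ((separatingForests G u v).filter fun F => F.Reachable u x).card

open Classical in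
theorem forestPotential_sub (x y : V) :
    forestPotential G u v x - forestPotential G u v y =
      ((separatingForests G u v |>.filter fun F => F.Reachable u x ∧ ¬F.Reachable u y).card : ℝ) -
      ((separatingForests G u v |>.filter fun F => F.Reachable u y ∧ ¬F.Reachable u x).card : ℝ) := by
  simp only [forestPotential, Finset.natCast_card_filter, ← Finset.sum_sub_distrib]
  refine Finset.sum_congr rfl fun F _ => ?_
  by_cases hx : F.Reachable u x <;> by_cases hy : F.Reachable u y <;> simp [hx, hy]

-- Trees with both `u` and `v` beyond `xy`, or neither, cancel. Hence the net crossing splits into a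
-- term for `v` alone and one for `u` alone, each summable over `y`.
open Classical in
theorem forestPotential_sub_eq_sum {x y : V} (hxy : G.Adj x y) :
    forestPotential G u v x - forestPotential G u v y =
      ∑ τ ∈ spanningTrees G,
        ((if τ.Adj x y ∧ (τ.deleteEdges {s(x, y)}).Reachable y v then (1 : ℝ) else 0) -
          if τ.Adj x y ∧ (τ.deleteEdges {s(x, y)}).Reachable y u then (1 : ℝ) else 0) := by
  rw [forestPotential_sub, card_separatingForests_filter hxy, card_separatingForests_filter hxy.symm]
  simp only [Finset.natCast_card_filter, ← Finset.sum_sub_distrib]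
  refine Finset.sum_congr rfl fun τ hτ => ?_
  by_cases hadj : τ.Adj x y
  · have hF := isTwoForest_deleteEdges (mem_spanningTrees.1 hτ).2 hadj
    have hu := hF.reachable_right_iff u
    have hv := hF.reachable_right_iff v
    rw [Sym2.eq_swap (a := y) (b := x)]
    simp only [hadj, hadj.symm, true_and, reachable_comm (u := y), reachable_comm (u := u) (v := x),
      hu, hv]
    by_cases h1 : (τ.deleteEdges {s(x, y)}).Reachable x u <;>
      by_cases h2 : (τ.deleteEdges {s(x, y)}).Reachable x v <;> simp [h1, h2]
  · simp [hadj, adj_comm τ y x]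

open Classical in
theorem sum_adj_reachable {τ : SimpleGraph V} (hτ : τ ∈ spanningTrees G) (x w : V) :
    (∑ y ∈ G.neighborFinset x,
      if τ.Adj x y ∧ (τ.deleteEdges {s(x, y)}).Reachable y w then (1 : ℝ) else 0) =
      if x = w then 0 else 1 := by
  obtain ⟨hle, hτ⟩ := mem_spanningTrees.1 hτ
  split_ifs with hxw
  · subst hxw
    refine Finset.sum_eq_zero fun y _ => if_neg fun h => ?_
    exact (isTwoForest_deleteEdges hτ h.1).not_reachable h.2.symm
  · obtain ⟨y, hy, huniq⟩ := existsUnique_adj_reachable hτ hxw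
    rw [Finset.sum_eq_single y, if_pos hy]
    · exact fun z _ hz => if_neg fun h => hz (huniq z h)
    · exact fun h => absurd ((mem_neighborFinset ..).2 (hle hy.1)) h

-- Kirchhoff's current law, tree by tree: each contributes `[x ≠ v] - [x ≠ u]`.
open Classical in
theorem lapMatrix_mulVec_forestPotential (G : SimpleGraph V) (u v x : V) :
    (G.lapMatrix ℝ).mulVec (forestPotential G u v) x =
      (spanningTrees G).card * ((if x = u then 1 else 0) - if x = v then 1 else 0) := by
  rw [lapMatrix_mulVec_apply, ← card_neighborFinset_eq_degree, ← nsmul_eq_mul, ← Finset.sum_const,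
    ← Finset.sum_sub_distrib, Finset.sum_congr rfl fun y hy =>
      forestPotential_sub_eq_sum ((mem_neighborFinset ..).1 hy), Finset.sum_comm]
  rw [Finset.sum_congr rfl fun τ hτ => by
    rw [Finset.sum_sub_distrib, sum_adj_reachable hτ, sum_adj_reachable hτ]]
  rw [Finset.sum_const, nsmul_eq_mul]
  congr 1
  split_ifs <;> simp

theorem forestPotential_right : forestPotential G u v v = 0 := by
  classical
  simp only [forestPotential, Nat.cast_eq_zero, Finset.card_eq_zero, Finset.filter_eq_empty_iff]
  exact fun F hF => (mem_separatingForests.1 hF).2.not_reachable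

-- Every separating forest counts at `u`, and adding `uv` turns it into a tree through `uv`.
open Classical in
theorem forestPotential_left (huv : G.Adj u v) :
    forestPotential G u v u = (spanningTreesThrough G s(u, v)).card := by
  have h := forestPotential_sub (G := G) (u := u) (v := v) u v
  have h0 : (separatingForests G u v |>.filter
      fun F => F.Reachable u v ∧ ¬F.Reachable u u) = ∅ := by simp
  rw [forestPotential_right, sub_zero, card_separatingForests_filter huv, h0, Finset.card_empty,
    Nat.cast_zero, sub_zero] at h
  rw [h, spanningTreesThrough]
  congr 2
  ext τ
  simp

end Counting

/-! ### Effective resistance as a proportion of trees -/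

section Resistance

variable {V : Type*} [Fintype V] {G : SimpleGraph V} {u v : V}

open Classical in
theorem effectiveResistance_eq_sum (G : SimpleGraph V) (u v : V) :
    effectiveResistance G u v =
      ∑ i, ((G.isHermitian_lapMatrix ℝ).eigenvalues i)⁻¹ *
        ((G.isHermitian_lapMatrix ℝ).eigenvectorBasis i u -
          (G.isHermitian_lapMatrix ℝ).eigenvectorBasis i v) ^ 2 := by
  simp only [effectiveResistance, lapPseudoInv, Matrix.sum_apply, Matrix.smul_apply,
    Matrix.of_apply, smul_eq_mul, ← Finset.sum_sub_distrib, ← Finset.sum_add_distrib]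
  rw [Finset.sum_filter]
  refine Finset.sum_congr rfl fun i _ => ?_
  split_ifs with h
  · ring
  -- Zero eigenvalues may join the sum since `0⁻¹ = 0`.
  · rw [not_not.1 h]
    simp

open Classical in
/-- The effective resistance is the potential difference which drives a unit current. -/
theorem mul_effectiveResistance_of_mulVec_eq (φ : V → ℝ) (t : ℝ)
    (hφ : ∀ x, (G.lapMatrix ℝ).mulVec φ x = t * ((if x = u then 1 else 0) - if x = v then 1 else 0)) :
    t * (t * effectiveResistance G u v) = t * (φ u - φ v) := by
  set hL := G.isHermitian_lapMatrix ℝ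
  have hpair : ∀ i, hL.eigenvalues i * ∑ x, hL.eigenvectorBasis i x * φ x =
      t * (hL.eigenvectorBasis i u - hL.eigenvectorBasis i v) := fun i => by
    have h1 : (hL.eigenvectorBasis i : V → ℝ) ⬝ᵥ (G.lapMatrix ℝ).mulVec φ =
        hL.eigenvalues i * ∑ x, hL.eigenvectorBasis i x * φ x := by
      rw [Matrix.dotProduct_mulVec, ← Matrix.mulVec_transpose, (G.isSymm_lapMatrix (R := ℝ)).eq,
        hL.mulVec_eigenvectorBasis, smul_dotProduct, smul_eq_mul, dotProduct]
    rw [← h1, dotProduct]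
    simp only [hφ, mul_left_comm _ t, mul_sub, Finset.sum_sub_distrib]
    simp
  have hexp : ∀ z, φ z = ∑ i, (∑ x, hL.eigenvectorBasis i x * φ x) * hL.eigenvectorBasis i z :=
    fun z => by
    have h := hL.eigenvectorBasis.sum_repr (WithLp.toLp 2 φ)
    have h' := congrArg (fun w : EuclideanSpace ℝ V => w z) h
    simp only [OrthonormalBasis.repr_apply_apply] at h'
    simpa [PiLp.inner_apply, mul_comm] using h'.symm
  rw [effectiveResistance_eq_sum, hexp u, hexp v, ← Finset.sum_sub_distrib, Finset.mul_sum,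
    Finset.mul_sum, Finset.mul_sum]
  refine Finset.sum_congr rfl fun i _ => ?_
  have h := hpair i
  rcases eq_or_ne (hL.eigenvalues i) 0 with h0 | h0
  -- On the kernel the pairing gives `t * (w u - w v) = 0`. The extra factor `t` in the statement
  -- lets this apply without connectedness or `t ≠ 0`.
  · rw [h0, zero_mul] at h
    rw [h0, ← mul_sub, mul_left_comm t (∑ x, _), ← h]
    simp
  · have h2 : ∑ x, hL.eigenvectorBasis i x * φ x =
        t * (hL.eigenvectorBasis i u - hL.eigenvectorBasis i v) * (hL.eigenvalues i)⁻¹ := by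
      rw [← h]; field_simp
    rw [h2]
    ring

/-- **Kirchhoff's theorem**: the effective resistance of an edge is the proportion of the spanning
trees that contain it. -/
theorem card_mul_effectiveResistance (huv : G.Adj u v) (hT : (spanningTrees G).Nonempty) :
    (spanningTrees G).card * effectiveResistance G u v = (spanningTreesThrough G s(u, v)).card := by
  have h := mul_effectiveResistance_of_mulVec_eq (forestPotential G u v) (spanningTrees G).card
    (lapMatrix_mulVec_forestPotential G u v)
  rw [forestPotential_right, sub_zero, forestPotential_left huv] at h
  exact mul_left_cancel₀ (Nat.cast_ne_zero.2 hT.card_pos.ne') h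

end Resistance

end TreeMaintenance

/-! ### Link-cut, cut-link and double counting -/

namespace TreeMaintenance

section Exchange

variable {V : Type*} {u v : V} {τ τ' : SimpleGraph V}

/-- Exposes the intermediate forest: an edge lies on the tree path exactly when its removal
separates `u` from `v`. -/
theorem isLinkCut_iff (hτ : τ.IsTree) :
    IsLinkCut u v τ τ' ↔ ¬τ.Adj u v ∧ ∃ x y, τ.Adj x y ∧
      IsTwoForest (τ.deleteEdges {s(x, y)}) u v ∧ τ' = τ.deleteEdges {s(x, y)} ⊔ edge u v := by
  rw [IsLinkCut, mem_edgeSet]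
  refine and_congr_right fun huv => ?_
  have hdel : ∀ x y, τ.Adj x y → (τ ⊔ fromEdgeSet {s(u, v)}).deleteEdges {s(x, y)} =
      τ.deleteEdges {s(x, y)} ⊔ edge u v := by
    intro x y hxy
    have hne : s(x, y) ≠ s(u, v) := fun h => huv ((adj_congr_of_sym2 τ h).1 hxy)
    ext a b
    simp only [deleteEdges_adj, sup_adj, edge, fromEdgeSet_adj, Set.mem_singleton_iff]
    grind
  constructor
  · rintro ⟨p, g, hp, hg, rfl⟩
    have hgτ := p.edges_subset_edgeSet hg
    induction g with | h x y => ?_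
    exact ⟨x, y, hgτ, (isTwoForest_deleteEdges hτ hgτ).of_not_reachable
      ((mem_edges_iff_not_reachable hτ.isAcyclic hp).1 hg), hdel x y hgτ⟩
  · rintro ⟨x, y, hxy, hF, rfl⟩
    obtain ⟨p, hp, -⟩ := hτ.existsUnique_path u v
    exact ⟨p, s(x, y), hp, (mem_edges_iff_not_reachable hτ.isAcyclic hp).2 hF.not_reachable,
      (hdel x y hxy).symm⟩

theorem IsLinkCut.adj (huv : u ≠ v) (hτ : τ.IsTree) (h : IsLinkCut u v τ τ') : τ'.Adj u v := by
  obtain ⟨-, x, y, -, -, rfl⟩ := (isLinkCut_iff hτ).1 h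
  exact Or.inr ((edge_adj ..).2 ⟨Or.inl ⟨rfl, rfl⟩, huv⟩)

end Exchange

section LinkCutGraph

variable {V : Type*} [Fintype V] {G : SimpleGraph V} {u v : V} {τ τe : SimpleGraph V}

theorem mem_spanningTrees_deleteEdges :
    τ ∈ spanningTrees (G.deleteEdges {s(u, v)}) ↔ (τ ≤ G ∧ τ.IsTree) ∧ ¬τ.Adj u v := by
  rw [mem_spanningTrees, and_right_comm]
  refine and_congr_left fun _ => ⟨fun h => ⟨h.trans (deleteEdges_le _), fun huv => ?_⟩, fun h => ?_⟩
  · simpa using h huv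
  · intro x y hxy
    exact deleteEdges_adj.2 ⟨h.1 hxy, fun he => h.2 ((adj_congr_of_sym2 τ he).1 hxy)⟩

theorem mem_linkCutNeighbors_comm :
    τ ∈ linkCutNeighbors G u v τe ↔ τe ∈ linkCutNeighbors G u v τ := by
  simp only [linkCutNeighbors, mem_neighborFinset, adj_comm]

theorem card_linkCutNeighbors : (linkCutNeighbors G u v τ).card = linkCutDegree G u v τ := rfl

theorem mem_linkCutNeighbors_iff (h : τe.Adj u v) :
    τ ∈ linkCutNeighbors G u v τe ↔
      τ ∈ spanningTrees G ∧ τe ∈ spanningTrees G ∧ IsLinkCut u v τ τe := by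
  rw [linkCutNeighbors, mem_neighborFinset, linkCutGraph, fromRel_adj]
  constructor
  · rintro ⟨-, h' | h'⟩
    · exact absurd h h'.2.2.1
    · exact h'
  · rintro h'
    refine ⟨?_, Or.inr h'⟩
    rintro rfl
    exact h'.2.2.1 h

theorem linkCutNeighbors_subset (h : τe ∈ spanningTreesThrough G s(u, v))
    (hτ : τ ∈ linkCutNeighbors G u v τe) : τ ∈ spanningTrees (G.deleteEdges {s(u, v)}) := by
  have hadj := (mem_spanningTreesThrough.1 h).2
  have h' := (mem_linkCutNeighbors_iff hadj).1 hτ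
  exact mem_spanningTrees_deleteEdges.2 ⟨mem_spanningTrees.1 h'.1, h'.2.2.1⟩

theorem linkCutNeighbors_subset_through (huv : u ≠ v)
    (h : τ ∈ spanningTrees (G.deleteEdges {s(u, v)})) (hτ : τe ∈ linkCutNeighbors G u v τ) :
    τe ∈ spanningTreesThrough G s(u, v) := by
  have hnadj := (mem_spanningTrees_deleteEdges.1 h).2
  rw [linkCutNeighbors, mem_neighborFinset, linkCutGraph, fromRel_adj] at hτ
  rcases hτ.2 with h' | h'
  · exact mem_spanningTreesThrough.2
      ⟨mem_spanningTrees.1 h'.2.1, h'.2.2.adj huv (mem_spanningTrees.1 h'.1).2⟩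
  · exact absurd (h'.2.2.adj huv (mem_spanningTrees.1 h'.1).2) hnadj

theorem mem_linkCutNeighbors_iff_isCutLink (h : τe ∈ spanningTreesThrough G s(u, v)) :
    τ ∈ linkCutNeighbors G u v τe ↔ IsCutLink G s(u, v) τe τ := by
  obtain ⟨⟨hle, htree⟩, hadj⟩ := mem_spanningTreesThrough.1 h
  rw [mem_linkCutNeighbors_iff hadj, mem_spanningTrees, IsCutLink, mem_edgeSet]
  have hF := isTwoForest_deleteEdges htree hadj
  constructor
  · rintro ⟨⟨hτle, hτ⟩, -, hlc⟩
    obtain ⟨hnadj, x, y, hxy, hF', heq⟩ := (isLinkCut_iff hτ).1 hlc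
    refine ⟨hadj, s(x, y), hτle hxy, fun he => hnadj ((adj_congr_of_sym2 τ he).1 hxy), ?_,
      hτ.connected⟩
    rw [← (hF'.sup_edge_eq_iff hadj).1 heq.symm]
    exact (deleteEdges_sup_edge hxy).symm
  · rintro ⟨-, g, hg, hne, heq, hconn⟩
    induction g with | h x y => ?_
    have hxy : G.Adj x y := hg
    change τ = τe.deleteEdges {s(u, v)} ⊔ edge x y at heq
    -- If the forest already joined `x` to `y`, linking them would leave `u` cut off from `v`,
    -- against the connectedness of `τ`.
    have hxyF : IsTwoForest (τe.deleteEdges {s(u, v)}) x y := by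
      refine hF.of_not_reachable fun hr => hF.not_reachable ?_
      refine forall_of_preconnected hconn.preconnected (fun a b hab ha => ?_) (Reachable.refl u) v
      rw [heq, sup_adj, edge_adj] at hab
      rcases hab with hab | ⟨⟨rfl, rfl⟩ | ⟨rfl, rfl⟩, -⟩
      · exact ha.trans hab.reachable
      · exact ha.trans hr
      · exact ha.trans hr.symm
    have hτ : τ.IsTree := heq ▸ hxyF.isTree_sup_edge
    have hτxy : τ.Adj x y := heq ▸ Or.inr ((edge_adj ..).2 ⟨Or.inl ⟨rfl, rfl⟩, hxy.ne⟩)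
    have hdel := (hxyF.sup_edge_eq_iff hτxy).1 heq.symm
    refine ⟨⟨?_, hτ⟩, mem_spanningTrees.2 ⟨hle, htree⟩, (isLinkCut_iff hτ).2 ⟨?_, x, y, hτxy, ?_, ?_⟩⟩
    · rw [heq]
      exact sup_le ((deleteEdges_le _).trans hle) ((edge_le_iff _).2 (Or.inr hxy))
    · rw [heq, sup_adj]
      rintro (h' | h')
      · exact hF.not_adj h'
      · refine hne (Sym2.eq_iff.2 ?_)
        have := ((edge_adj ..).1 h').1
        grind
    · rwa [← hdel]
    · rw [← hdel]
      exact (deleteEdges_sup_edge hadj).symm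

theorem linkCutNeighbors_nonempty (hG : (G.deleteEdges {s(u, v)}).Connected)
    (h : τe ∈ spanningTreesThrough G s(u, v)) : (linkCutNeighbors G u v τe).Nonempty := by
  obtain ⟨⟨hle, htree⟩, hadj⟩ := mem_spanningTreesThrough.1 h
  have hF := isTwoForest_deleteEdges htree hadj
  -- As the graph without `uv` is connected, one of its edges crosses the cut.
  obtain ⟨x, y, hxy, hnr⟩ : ∃ x y, (G.deleteEdges {s(u, v)}).Adj x y ∧
      ¬(τe.deleteEdges {s(u, v)}).Reachable x y := by
    by_contra! hcon
    exact hF.not_reachable (forall_of_preconnected hG.preconnected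
      (fun a b hab ha => ha.trans (hcon a b hab)) (Reachable.refl u) v)
  rw [deleteEdges_adj] at hxy
  exact ⟨_, (mem_linkCutNeighbors_iff_isCutLink h).2 ⟨hadj, s(x, y), hxy.1, hxy.2, rfl,
    (hF.of_not_reachable hnr).isTree_sup_edge.connected⟩⟩

theorem linkCutDegree_pos (huv : G.Adj u v) (h : τ ∈ spanningTrees (G.deleteEdges {s(u, v)})) :
    0 < linkCutDegree G u v τ := by
  obtain ⟨⟨hle, htree⟩, hnadj⟩ := mem_spanningTrees_deleteEdges.1 h
  -- The edge to cut is the first one on the tree path from `u` to `v`.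
  obtain ⟨y, hy, hr⟩ := (existsUnique_adj_reachable htree huv.ne).exists
  have hF := isTwoForest_deleteEdges htree hy
  have hF' : IsTwoForest (τ.deleteEdges {s(u, y)}) u v :=
    hF.of_not_reachable fun h => hF.not_reachable (h.trans hr.symm)
  have hadj : (τ.deleteEdges {s(u, y)} ⊔ edge u v).Adj u v :=
    Or.inr ((edge_adj ..).2 ⟨Or.inl ⟨rfl, rfl⟩, huv.ne⟩)
  rw [← card_linkCutNeighbors, Finset.card_pos]
  refine ⟨τ.deleteEdges {s(u, y)} ⊔ edge u v, mem_linkCutNeighbors_comm.1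
    ((mem_linkCutNeighbors_iff hadj).2 ⟨mem_spanningTrees.2 ⟨hle, htree⟩,
      mem_spanningTrees.2 ⟨?_, hF'.isTree_sup_edge⟩,
      (isLinkCut_iff htree).2 ⟨hnadj, u, y, hy, hF', rfl⟩⟩)⟩
  exact sup_le ((deleteEdges_le _).trans hle) ((edge_le_iff _).2 (Or.inr huv))

theorem card_spanningTrees_add (G : SimpleGraph V) (u v : V) :
    (spanningTrees (G.deleteEdges {s(u, v)})).card + (spanningTreesThrough G s(u, v)).card =
      (spanningTrees G).card := by
  classical
  rw [← Finset.card_filter_add_card_filter_not (s := spanningTrees G) (fun τ => ¬τ.Adj u v)]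
  congr 2 <;> ext τ
  · rw [mem_spanningTrees_deleteEdges, Finset.mem_filter, mem_spanningTrees]
  · simp [mem_spanningTreesThrough, mem_spanningTrees]

/-- Double counting over the edges of the link-cut graph. -/
theorem sum_expect_linkCutNeighbors (huv : G.Adj u v) (hG : (G.deleteEdges {s(u, v)}).Connected)
    (f : SimpleGraph V → ℝ) :
    ∑ τe ∈ spanningTreesThrough G s(u, v), 𝔼 τ ∈ linkCutNeighbors G u v τe,
        (f τ * ((linkCutDegree G u v τe : ℝ) / (linkCutDegree G u v τ : ℝ))) =
      ∑ τ ∈ spanningTrees (G.deleteEdges {s(u, v)}), f τ := by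
  have h1 : ∀ τe ∈ spanningTreesThrough G s(u, v), 𝔼 τ ∈ linkCutNeighbors G u v τe,
        (f τ * ((linkCutDegree G u v τe : ℝ) / (linkCutDegree G u v τ : ℝ))) =
      ∑ τ ∈ linkCutNeighbors G u v τe, f τ / linkCutDegree G u v τ := fun τe h => by
    have hpos : (linkCutDegree G u v τe : ℝ) ≠ 0 :=
      Nat.cast_ne_zero.2 (linkCutNeighbors_nonempty hG h).card_pos.ne'
    rw [Finset.expect_eq_sum_div_card, card_linkCutNeighbors, Finset.sum_div]
    exact Finset.sum_congr rfl fun τ _ => by field_simp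
  rw [Finset.sum_congr rfl h1, Finset.sum_comm' (s' := fun τ => linkCutNeighbors G u v τ)
    (t' := spanningTrees (G.deleteEdges {s(u, v)}))]
  · refine Finset.sum_congr rfl fun τ h => ?_
    have hpos : (linkCutDegree G u v τ : ℝ) ≠ 0 := Nat.cast_ne_zero.2 (linkCutDegree_pos huv h).ne'
    rw [Finset.sum_const, card_linkCutNeighbors, nsmul_eq_mul]
    field_simp
  · exact fun τe τ => ⟨fun h => ⟨mem_linkCutNeighbors_comm.1 h.2, linkCutNeighbors_subset h.1 h.2⟩,
      fun h => ⟨linkCutNeighbors_subset_through huv.ne h.2 h.1, mem_linkCutNeighbors_comm.1 h.1⟩⟩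

end LinkCutGraph

end TreeMaintenance

/-! ### The sampling identity -/

theorem mainTheorem8 {V : Type*} [Fintype V] (G' : SimpleGraph V) (u v : V)
    (he : G'.Adj u v) (hG : (G'.deleteEdges {s(u, v)}).Connected) (f : SimpleGraph V → ℝ) :
    let Γ := TreeMaintenance.spanningTrees (G'.deleteEdges {s(u, v)})
    let Γe := TreeMaintenance.spanningTreesThrough G' s(u, v)
    let R := TreeMaintenance.effectiveResistance G' u v
    let N := TreeMaintenance.linkCutNeighbors G' u v
    let d := TreeMaintenance.linkCutDegree G' u v
    (∀ τe ∈ Γe, ∀ τ, τ ∈ N τe ↔ TreeMaintenance.IsCutLink G' s(u, v) τe τ) ∧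
    Γ.Nonempty ∧ Γe.Nonempty ∧ (∀ τe ∈ Γe, (N τe).Nonempty) ∧ (∀ τ ∈ Γ, 0 < d τ) ∧ R < 1 ∧
    𝔼 τ ∈ Γ, f τ =
      R / (1 - R) * 𝔼 τe ∈ Γe, 𝔼 τ ∈ N τe, (f τ * ((d τe : ℝ) / (d τ : ℝ))) := by
  intro Γ Γe R N d
  have hΓ : Γ.Nonempty := by
    obtain ⟨T, hT, hT'⟩ := hG.exists_isTree_le
    exact ⟨T, TreeMaintenance.mem_spanningTrees.2 ⟨hT, hT'⟩⟩
  have hΓe : Γe.Nonempty := by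
    obtain ⟨τ, hτ⟩ := hΓ
    obtain ⟨τe, hτe⟩ := Finset.card_pos.1 (TreeMaintenance.linkCutDegree_pos he hτ)
    exact ⟨τe, TreeMaintenance.linkCutNeighbors_subset_through he.ne hτ hτe⟩
  have hcard := TreeMaintenance.card_spanningTrees_add G' u v
  have hpos : (0 : ℝ) < Γ.card := Nat.cast_pos.2 hΓ.card_pos
  have hpos' : (0 : ℝ) < Γe.card := Nat.cast_pos.2 hΓe.card_pos
  have hR : ((Γ.card : ℝ) + Γe.card) * R = Γe.card := by
    have h := TreeMaintenance.card_mul_effectiveResistance he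
      (Finset.card_pos.1 (hcard ▸ Nat.add_pos_left hΓ.card_pos _))
    rwa [← hcard, Nat.cast_add] at h
  have hR' : R = Γe.card / (Γ.card + Γe.card) := by
    rw [eq_div_iff (by positivity), mul_comm, hR]
  have hR1 : 1 - R = Γ.card / (Γ.card + Γe.card) := by
    rw [hR']
    field_simp
    ring
  refine ⟨fun τe h τ => TreeMaintenance.mem_linkCutNeighbors_iff_isCutLink h, hΓ, hΓe,
    fun τe h => TreeMaintenance.linkCutNeighbors_nonempty hG h,
    fun τ h => TreeMaintenance.linkCutDegree_pos he h, ?_, ?_⟩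
  · rw [← sub_pos, hR1]
    positivity
  · rw [hR1, hR', Finset.expect_eq_sum_div_card, Finset.expect_eq_sum_div_card,
      TreeMaintenance.sum_expect_linkCutNeighbors he hG f]
    field_simp
    rfl
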